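/- All graphs are finite, undirected and simple; $\mathbb{N}=\{1,2,\dots\}$. For a graph $G$ and $A,B\subseteq V(G)$, let $G\oplus(A,B)$ be the graph on $V(G)$ in which two distinct vertices $u,v$ are adjacent if and only if either $(u,v)\in(A\times B)\cup(B\times A)$ and $uv\notin E(G)$, or $(u,v)\notin(A\times B)\cup(B\times A)$ and $uv\in E(G)$. A $k$-flip of $G$ is a graph $G\oplus(A_1,B_1)\oplus\cdots\oplus(A_m,B_m)$ such that all $A_i,B_i$ are parts of one partition of $V(G)$ into at most $k$ parts. In the flipper game of radius $r\in\mathbb{N}\cup\{\infty\}$ and width $k\in\mathbb{N}$ on $G$, put $G_0=G$; the runner chooses a vertex $v_0$; in each round $i\ge 1$ the flipper announces a $k$-flip $G_i$ of $G$, and then the runner, knowing $G_i$, moves from $v_{i-1}$ to a vertex $v_i$ along a path of length at most $r$ (possibly $0$) in $G_{i-1}$. The flipper wins if in some round $i\ge 1$ the vertex $v_i$ is isolated in $G_i$. The radius-$r$ flip-width $\mathrm{fw}_r(G)$ is the minimum $k\in\mathbb{N}$ for which the flipper has a winning strategy. Let $P$ be the path $p_1p_2p_3p_4$ on four vertices.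 Let $C_5$ be the cycle on five vertices, and let the bull, the gem and the co-gem be the graphs obtained from $P$ by adding one vertex adjacent to exactly $p_2$ and $p_3$, to all of $p_1,\dots,p_4$, and to none of them, respectively. A graph is $(C_5,\text{bull},\text{gem},\text{co-gem})$-free if it has no induced subgraph isomorphic to one of these four graphs. A bi-join in $G$ is a pair $(V_1,V_2)$ of disjoint nonempty sets with union $V(G)$ for which there are $W_1\subseteq V_1$ and $W_2\subseteq V_2$ such that every vertex of $W_1$ is adjacent to all of $W_2$ and to no vertex of $V_2\setminus W_2$, and every vertex of $V_1\setminus W_1$ is adjacent to all of $V_2\setminus W_2$ and to no vertex of $W_2$. A graph is totally decomposable with respect to bi-joins if each of its induced subgraphs on at least $4$ vertices has a bi-join $(V_1,V_2)$ with $|V_1|\ge 2$ and $|V_2|\ge 2$. **Theorem.** (1) For every $r\in(\mathbb{N}\setminus\{1\})\cup\{\infty\}$ and every graph $G$, $\mathrm{fw}_r(G)\le 2$ if and only if $G$ is $(C_5,\text{bull},\text{gem},\text{co-gem})$-free. (2) A graph is $(C_5,\text{bull},\text{gem},\text{co-gem})$-free if and only if it is totally decomposable with respect to bi-joins. (3)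 If $G$ is $(C_5,\text{bull},\text{gem},\text{co-gem})$-free, then $\mathrm{fw}_r(G)\le 2$ for every $r\in\mathbb{N}\cup\{\infty\}$, including $r=1$. (4) For every $r\in(\mathbb{N}\setminus\{1\})\cup\{\infty\}$, each of $C_5$, the bull, the gem and the co-gem has radius-$r$ flip-width at least $3$. -/

import Mathlib

universe u

namespace FlipWidth

variable {V : Type u}

/-- `G ⊕ (A, B)`: the adjacency of distinct `u`, `v` is complemented exactly when
`(u, v) ∈ (A × B) ∪ (B × A)`. -/
def flipPair (G : SimpleGraph V) (A B : Set V) : SimpleGraph V where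
  Adj u v := u ≠ v ∧
    (((u, v) ∈ A ×ˢ B ∪ B ×ˢ A ∧ ¬ G.Adj u v) ∨ ((u, v) ∉ A ×ˢ B ∪ B ×ˢ A ∧ G.Adj u v))
  symm := ⟨by
    intro u v h
    simp only [Set.mem_union, Set.mem_prod, G.adj_comm v u] at h ⊢
    tauto⟩
  loopless := ⟨fun _ h => h.1 rfl⟩

/-- `G ⊕ (A₁, B₁) ⊕ ⋯ ⊕ (Aₘ, Bₘ)`. -/
def flipList (G : SimpleGraph V) (S : List (Set V × Set V)) : SimpleGraph V :=
  S.foldl (fun H p => flipPair H p.1 p.2) G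

/-- `G'` is a `P`-flip of `G`: it arises by flipping pairs of (possibly equal) parts of `P`. -/
def IsFlip (G : SimpleGraph V) (P : Set (Set V)) (G' : SimpleGraph V) : Prop :=
  ∃ S : List (Set V × Set V), (∀ p ∈ S, p.1 ∈ P ∧ p.2 ∈ P) ∧ G' = flipList G S

/-- `G'` is a `k`-flip of `G`: a `P`-flip for a partition `P` of the vertex set into at most
`k` (nonempty) parts. -/
def IsKFlip (k : ℕ) (G G' : SimpleGraph V) : Prop :=
  ∃ P : Set (Set V), Setoid.IsPartition P ∧ P.encard ≤ k ∧ IsFlip G P G'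

/-- There is a path of length at most `r` from `u` to `v` in `H`; staying put is allowed. -/
def CanMove (r : ℕ∞) (H : SimpleGraph V) (u v : V) : Prop :=
  ∃ p : H.Walk u v, p.IsPath ∧ (p.length : ℕ∞) ≤ r

/-- A strategy of the flipper in the flipper game of width `k` on `G`: in round `i ≥ 1` the flipper
sees the positions `[v₀, …, v_{i-1}]` taken so far by the runner and announces a `k`-flip of `G`. -/
structure Strategy (G : SimpleGraph V) (k : ℕ) where
  move : List V → SimpleGraph V
  isKFlip : ∀ l, IsKFlip k G (move l)

namespace Strategy

variable {G : SimpleGraph V} {k : ℕ}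

/-- The graph `Gᵢ` when the runner takes the positions `v 0, v 1, …`: `G₀ = G`, and `Gᵢ` for
`i ≥ 1` is the answer of the strategy to `[v 0, …, v (i - 1)]`. -/
def graphAt (σ : Strategy G k) (v : ℕ → V) : ℕ → SimpleGraph V
  | 0 => G
  | i + 1 => σ.move ((List.range (i + 1)).map v)

/-- The runner's positions obey the rules of the game of radius `r` against `σ`: the new position
`vᵢ` is reached from `v_{i-1}` by a path of length at most `r` in the previous graph `G_{i-1}`. -/
def IsPlay (σ : Strategy G k) (r : ℕ∞) (v : ℕ → V) : Prop :=
  ∀ i, CanMove r (σ.graphAt v i) (v i) (v (i + 1))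

/-- Against `σ`, the runner is always caught: in some round `i ≥ 1` the position `vᵢ` is isolated
in `Gᵢ`. -/
def IsWinning (σ : Strategy G k) (r : ℕ∞) : Prop :=
  ∀ v : ℕ → V, σ.IsPlay r v → ∃ i, 1 ≤ i ∧ (σ.graphAt v i).IsIsolated (v i)

end Strategy

/-- The radius-`r` flip-width of `G`: the minimum `k ≥ 1` for which the flipper has a winning
strategy in the flipper game of radius `r` and width `k`. -/
noncomputable def flipWidth (r : ℕ∞) (G : SimpleGraph V) : ℕ∞ :=
  ⨅ (k : ℕ) (_ : 1 ≤ k ∧ ∃ σ : Strategy G k, σ.IsWinning r), (k : ℕ∞)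

/-- The cycle on five vertices. -/
abbrev c5 : SimpleGraph (Fin 5) := SimpleGraph.cycleGraph 5

/-- The path `0, 1, 2, 3` with a vertex `4` adjacent to `1` and `2`. -/
def bull : SimpleGraph (Fin 5) :=
  SimpleGraph.fromRel fun a b => (a, b) ∈ [(0, 1), (1, 2), (2, 3), (4, 1), (4, 2)]

/-- The path `0, 1, 2, 3` with a vertex `4` adjacent to all of its vertices. -/
def gem : SimpleGraph (Fin 5) :=
  SimpleGraph.fromRel fun a b =>
    (a, b) ∈ [(0, 1), (1, 2), (2, 3), (4, 0), (4, 1), (4, 2), (4, 3)]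

/-- The path `0, 1, 2, 3` with an isolated vertex `4`. -/
def coGem : SimpleGraph (Fin 5) :=
  SimpleGraph.fromRel fun a b => (a, b) ∈ [(0, 1), (1, 2), (2, 3)]

/-- `G` has no induced subgraph isomorphic to `C₅`, the bull, the gem or the co-gem. -/
def ObsFree (G : SimpleGraph V) : Prop :=
  ¬ c5.IsIndContained G ∧ ¬ bull.IsIndContained G ∧ ¬ gem.IsIndContained G ∧
    ¬ coGem.IsIndContained G

/-- `A` is complete to `B`. -/
def CompleteTo (G : SimpleGraph V) (A B : Set V) : Prop :=
  ∀ a ∈ A, ∀ b ∈ B, G.Adj a b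

/-- `A` is anti-complete to `B`. -/
def AnticompleteTo (G : SimpleGraph V) (A B : Set V) : Prop :=
  ∀ a ∈ A, ∀ b ∈ B, ¬ G.Adj a b

/-- The ordered bipartition `(V₁, V₂)` of the vertex set is a bi-join in `G`. -/
def IsBiJoin (G : SimpleGraph V) (V₁ V₂ : Set V) : Prop :=
  V₁.Nonempty ∧ V₂.Nonempty ∧ V₁ ∩ V₂ = ∅ ∧ V₁ ∪ V₂ = Set.univ ∧
    ∃ W₁ ⊆ V₁, ∃ W₂ ⊆ V₂,
      CompleteTo G W₁ W₂ ∧ AnticompleteTo G W₁ (V₂ \ W₂) ∧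
      CompleteTo G (V₁ \ W₁) (V₂ \ W₂) ∧ AnticompleteTo G (V₁ \ W₁) W₂

/-- `G` is completely (totally) decomposable with respect to bi-joins: every induced subgraph on at
least four vertices has a bi-join both of whose sides have more than one vertex. -/
def CompletelyDecomposable (G : SimpleGraph V) : Prop :=
  ∀ S : Set V, 4 ≤ S.encard →
    ∃ V₁ V₂ : Set S, IsBiJoin (G.induce S) V₁ V₂ ∧ V₁.encard ≠ 1 ∧ V₂.encard ≠ 1

end FlipWidth

/-!
The four obstructions are the graphs made of an induced path on four vertices and a fifth vertex
whose neighbourhood is invariant under the reversal of the path, and they are exactly the induced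
subgraphs that become a pentagon under a Seidel switching. Hence freeness from the obstructions is
invariant under switching, as are the bi-joins of a graph. Every vertex can be isolated by a
switching, and it then forms a co-gem with any induced path on four vertices, so every free graph is
a switching of a graph without such paths.

In such a graph every module `X` with at least two elements splits into two modules `A` and `X \ A`
with all or no edges between them. If the runner is in `X`, some switching of the graph, or the
complement of one, has no edges leaving `A` or `X \ A`; it is a 2-flip, and it confines the runner
to a smaller module. A minimal module that is not a singleton has exactly two vertices, and it forms
a bi-join with its complement, whereas the pentagon has no bi-join with two vertices on each side.

On an obstruction, a runner whose moves all end on the path escapes every flipper of width 2: in a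
2-flip, at most one vertex of the path is at distance more than two from all the others.
-/

namespace FlipWidth

open SimpleGraph

section ColorFlip

variable {V W ι : Type*}

/-- The flip of `G` in which the adjacency of distinct `u` and `v` is complemented exactly when the
unordered pair of their colours under `t` belongs to `F`. The `k`-flips are the flips by at most `k`
colours. -/
def colorFlip (G : SimpleGraph V) (t : V → ι) (F : Set (Sym2 ι)) : SimpleGraph V where
  Adj u v := u ≠ v ∧ (G.Adj u v ↔ s(t u, t v) ∉ F)
  symm := ⟨fun u v h => by rwa [ne_comm, G.adj_comm, Sym2.eq_swap]⟩
  loopless := ⟨fun _ h => h.1 rfl⟩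

theorem colorFlip_adj {G : SimpleGraph V} {t : V → ι} {F : Set (Sym2 ι)} {u v : V} (h : u ≠ v) :
    (colorFlip G t F).Adj u v ↔ (G.Adj u v ↔ s(t u, t v) ∉ F) :=
  and_iff_right h

theorem colorFlip_empty (G : SimpleGraph V) (t : V → ι) : colorFlip G t ∅ = G := by
  ext u v
  simpa [colorFlip] using fun h : G.Adj u v => h.ne

theorem comap_colorFlip (G : SimpleGraph V) (t : V → ι) (F : Set (Sym2 ι)) (f : W ↪ V) :
    (colorFlip G t F).comap f = colorFlip (G.comap f) (t ∘ f) F := by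
  ext u v
  simp [colorFlip]

theorem flipPair_colorFlip (G : SimpleGraph V) (t : V → ι) (F : Set (Sym2 ι)) (i j : ι) :
    flipPair (colorFlip G t F) (t ⁻¹' {i}) (t ⁻¹' {j}) = colorFlip G t (symmDiff F {s(i, j)}) := by
  ext u v
  simp only [flipPair, colorFlip, Set.mem_union, Set.mem_prod, Set.mem_preimage,
    Set.mem_singleton_iff, Set.mem_symmDiff, Sym2.eq_iff]
  tauto

theorem flipPair_empty_left (G : SimpleGraph V) (B : Set V) : flipPair G ∅ B = G := by
  ext u v
  simpa [flipPair] using fun h : G.Adj u v => h.ne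

theorem flipPair_empty_right (G : SimpleGraph V) (A : Set V) : flipPair G A ∅ = G := by
  ext u v
  simpa [flipPair] using fun h : G.Adj u v => h.ne

theorem IsFlip.refl (G : SimpleGraph V) (P : Set (Set V)) : IsFlip G P G :=
  ⟨[], by simp, rfl⟩

theorem IsFlip.flipPair {G K : SimpleGraph V} {P : Set (Set V)} {A B : Set V} (h : IsFlip G P K)
    (hA : A = ∅ ∨ A ∈ P) (hB : B = ∅ ∨ B ∈ P) : IsFlip G P (flipPair K A B) := by
  obtain rfl | hA := hA
  · rwa [flipPair_empty_left]
  obtain rfl | hB := hB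
  · rwa [flipPair_empty_right]
  obtain ⟨S, hS, rfl⟩ := h
  refine ⟨S ++ [(A, B)], ?_, by simp [flipList]⟩
  simpa [or_imp, forall_and, hA, hB] using hS

theorem IsFlip.exists_eq_colorFlip {G K : SimpleGraph V} {P : Set (Set V)} {t : V → ι}
    (ht : ∀ A ∈ P, ∃ i, A = t ⁻¹' {i}) (h : IsFlip G P K) : ∃ F, K = colorFlip G t F := by
  obtain ⟨S, hS, rfl⟩ := h
  induction S using List.reverseRecOn with
  | nil => exact ⟨∅, (colorFlip_empty G t).symm⟩
  | append_singleton S p ih =>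
    obtain ⟨F, hF⟩ := ih fun q hq => hS q (by simp [hq])
    obtain ⟨i, hi⟩ := ht p.1 (hS p (by simp)).1
    obtain ⟨j, hj⟩ := ht p.2 (hS p (by simp)).2
    refine ⟨symmDiff F {s(i, j)}, ?_⟩
    rw [← flipPair_colorFlip, ← hF, ← hi, ← hj]
    simp [flipList]

theorem IsKFlip.exists_eq_colorFlip [Finite ι] {k : ℕ} (hk : k ≤ Nat.card ι) {G K : SimpleGraph V}
    (h : IsKFlip k G K) : ∃ (t : V → ι) (F : Set (Sym2 ι)), K = colorFlip G t F := by
  obtain ⟨P, hP, hPk, hK⟩ := h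
  obtain ⟨hPfin, hPcard⟩ := Set.encard_le_coe_iff_finite_ncard_le.1 hPk
  have := hPfin.fintype
  have := Fintype.ofFinite ι
  obtain ⟨e⟩ : Nonempty (P ↪ ι) := Function.Embedding.nonempty_of_card_le <| by
    rw [← Nat.card_eq_fintype_card, ← Nat.card_eq_fintype_card]
    exact hPcard.trans hk
  choose part hpart hunique using hP.2
  refine ⟨fun v => e ⟨part v, (hpart v).1⟩, hK.exists_eq_colorFlip fun A hA => ⟨e ⟨A, hA⟩, ?_⟩⟩
  ext v
  simp only [Set.mem_preimage, Set.mem_singleton_iff, e.apply_eq_iff_eq, Subtype.mk.injEq]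
  exact ⟨fun hv => (hunique v A ⟨hA, hv⟩).symm, fun h => h ▸ (hpart v).2⟩

theorem isKFlip_colorFlip [Finite ι] (G : SimpleGraph V) (t : V → ι) (F : Set (Sym2 ι)) :
    IsKFlip (Nat.card ι) G (colorFlip G t F) := by
  have hfibre (i : ι) : t ⁻¹' {i} = ∅ ∨ t ⁻¹' {i} ∈ (Setoid.ker t).classes := by
    refine (Set.eq_empty_or_nonempty _).imp_right ?_
    rintro ⟨v, rfl⟩
    exact (Setoid.ker t).mem_classes v
  refine ⟨(Setoid.ker t).classes, Setoid.isPartition_classes _, ?_, ?_⟩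
  · calc (Setoid.ker t).classes.encard
        ≤ (Set.range fun i => t ⁻¹' {i}).encard :=
          Set.encard_le_encard (Setoid.classes_ker_subset_fiber_set t)
      _ ≤ ENat.card ι := by
        rw [← Set.image_univ, ← Set.encard_univ]
        exact Set.encard_image_le _ _
      _ = Nat.card ι := ENat.card_eq_coe_natCard ι
  · induction F, F.toFinite using Set.Finite.induction_on with
    | empty => simpa only [colorFlip_empty] using IsFlip.refl G _
    | @insert p F hp _ ih =>
      induction p with
      | h i j =>
      have hinsert : insert s(i, j) F = symmDiff F {s(i, j)} := by
        rw [(Set.disjoint_singleton_right.2 hp).symmDiff_eq_sup, Set.insert_eq]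
        exact Set.union_comm _ _
      rw [hinsert, ← flipPair_colorFlip]
      exact ih.flipPair (hfibre i) (hfibre j)

theorem IsKFlip.mono {k l : ℕ} (hkl : k ≤ l) {G K : SimpleGraph V} (h : IsKFlip k G K) :
    IsKFlip l G K :=
  let ⟨P, hP, hk, hK⟩ := h
  ⟨P, hP, hk.trans (Nat.cast_le.2 hkl), hK⟩

theorem isKFlip_self {k : ℕ} (hk : 1 ≤ k) (G : SimpleGraph V) : IsKFlip k G G := by
  have h := isKFlip_colorFlip G (fun _ => ()) ∅
  rw [colorFlip_empty, Nat.card_unique] at h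
  exact h.mono hk

theorem IsKFlip.comap {k : ℕ} {G K : SimpleGraph V} (h : IsKFlip k G K) (f : W ↪ V) :
    IsKFlip k (G.comap f) (K.comap f) := by
  obtain ⟨t, F, rfl⟩ := h.exists_eq_colorFlip (ι := Fin k) (by simp)
  simpa [comap_colorFlip] using isKFlip_colorFlip (G.comap f) (t ∘ f) F

end ColorFlip

section Moves

variable {V W : Type*} {r : ℕ∞} {H K : SimpleGraph V}

theorem CanMove.of_walk {u v : V} (p : H.Walk u v) (hp : (p.length : ℕ∞) ≤ r) :
    CanMove r H u v := by
  classical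
  exact ⟨p.bypass, p.bypass_isPath, (Nat.cast_le.2 p.length_bypass_le_length).trans hp⟩

theorem CanMove.refl (r : ℕ∞) (H : SimpleGraph V) (v : V) : CanMove r H v v :=
  .of_walk .nil zero_le

theorem CanMove.of_adj {u v : V} (hr : 1 ≤ r) (h : H.Adj u v) : CanMove r H u v :=
  .of_walk h.toWalk (by simpa)

theorem CanMove.of_adj_adj {u v w : V} (hr : 2 ≤ r) (huv : H.Adj u v) (hvw : H.Adj v w) :
    CanMove r H u w :=
  .of_walk (.cons huv hvw.toWalk) (by simpa [one_add_one_eq_two])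

theorem CanMove.map {L : SimpleGraph W} {u v : V} (h : CanMove r H u v) (f : H →g L) :
    CanMove r L (f u) (f v) := by
  obtain ⟨p, -, hp⟩ := h
  exact .of_walk (p.map f) (by simpa)

theorem CanMove.not_isIsolated {u v : V} (h : CanMove r H u v) (huv : v ≠ u) :
    ¬ H.IsIsolated u := by
  obtain ⟨p, -, -⟩ := h
  cases p with
  | nil => exact absurd rfl huv
  | cons hadj _ => exact hadj.not_isIsolated_left

/-- No edge of `K` leaves `X`, so that the runner cannot leave `X` while moving in `K`. -/
def IsSeparated (K : SimpleGraph V) (X : Set V) : Prop :=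
  ∀ x ∈ X, ∀ y, K.Adj x y → y ∈ X

theorem IsSeparated.mem_of_canMove {X : Set V} (h : IsSeparated K X) {u v : V}
    (huv : CanMove r K u v) (hu : u ∈ X) : v ∈ X := by
  obtain ⟨p, -, -⟩ := huv
  induction p with
  | nil => exact hu
  | cons hadj _ ih => exact ih (h _ hu _ hadj)

theorem IsSeparated.isIsolated {X : Set V} (h : IsSeparated K X) (hX : X.Subsingleton) {v : V}
    (hv : v ∈ X) : K.IsIsolated v :=
  fun w hvw => hvw.ne (hX hv (h v hv w hvw))

end Moves

section Game

variable {V W : Type*} {G : SimpleGraph V} {H : SimpleGraph W} {k : ℕ} {r : ℕ∞}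

/-- The strategy of the flipper on an induced subgraph `H` of `G` that imagines the runner of `H`
playing on `G`. -/
def Strategy.comap (σ : Strategy G k) (f : H ↪g G) : Strategy H k where
  move l := (σ.move (l.map f)).comap f
  isKFlip l := by
    have h := (σ.isKFlip (l.map f)).comap f.toEmbedding
    rwa [show G.comap f.toEmbedding = H from f.comap_eq] at h

theorem Strategy.graphAt_comap (σ : Strategy G k) (f : H ↪g G) (v : ℕ → W) (i : ℕ) :
    (σ.comap f).graphAt v i = (σ.graphAt (f ∘ v) i).comap f := by
  cases i with
  | zero => exact f.comap_eq.symm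
  | succ i => simp [graphAt, comap]

theorem Strategy.IsWinning.comap {σ : Strategy G k} (hσ : σ.IsWinning r) (f : H ↪g G) :
    (σ.comap f).IsWinning r := by
  intro v hv
  simp only [Strategy.IsPlay, σ.graphAt_comap] at hv ⊢
  obtain ⟨i, hi, hcaught⟩ := hσ (f ∘ v) fun i => (hv i).map (Hom.comap f _)
  exact ⟨i, hi, fun w => hcaught (f w)⟩

theorem flipWidth_mono (h : H.IsIndContained G) (r : ℕ∞) : flipWidth r H ≤ flipWidth r G := by
  obtain ⟨f⟩ := h
  exact le_iInf₂ fun k ⟨hk, σ, hσ⟩ => iInf₂_le k ⟨hk, σ.comap f, hσ.comap f⟩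

/-- The graph in which the runner continues after visiting the vertices in the list. -/
def Strategy.graphAfter (σ : Strategy G k) : List V → SimpleGraph V
  | [] => G
  | v :: l => σ.move (v :: l)

theorem Strategy.graphAt_eq_graphAfter (σ : Strategy G k) (v : ℕ → V) (i : ℕ) :
    σ.graphAt v i = σ.graphAfter ((List.range i).map v) := by
  cases i with
  | zero => rfl
  | succ i => simp [graphAt, graphAfter, List.range_succ_eq_map]

theorem Strategy.exists_isPlay (σ : Strategy G k) {R : SimpleGraph V → V → Prop}
    (hinit : ∃ v, R G v)
    (hstep : ∀ K v, R K v → ∀ K', IsKFlip k G K' → ∃ w, CanMove r K v w ∧ R K' w) :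
    ∃ v : ℕ → V, σ.IsPlay r v ∧ ∀ i, R (σ.graphAt v i) (v i) := by
  obtain ⟨v₀, hv₀⟩ := hinit
  let State := {p : List V × V // R (σ.graphAfter p.1) p.2}
  have hnext (p : State) : ∃ q : State, q.1.1 = p.1.1 ++ [p.1.2] ∧
      CanMove r (σ.graphAfter p.1.1) p.1.2 q.1.2 := by
    have hflip : IsKFlip k G (σ.graphAfter (p.1.1 ++ [p.1.2])) := by
      cases p.1.1 <;> exact σ.isKFlip _
    obtain ⟨w, hmove, hw⟩ := hstep _ _ p.2 _ hflip
    exact ⟨⟨(_, w), hw⟩, rfl, hmove⟩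
  choose next hhistory hmove using hnext
  let state (i : ℕ) : State := next^[i] ⟨([], v₀), hv₀⟩
  have hsucc (i : ℕ) : state (i + 1) = next (state i) := Function.iterate_succ_apply' ..
  let v (i : ℕ) : V := (state i).1.2
  have hrange (i : ℕ) : (state i).1.1 = (List.range i).map v := by
    induction i with
    | zero => rfl
    | succ i ih => simp [hsucc, hhistory, List.range_succ, ih, v]
  refine ⟨v, fun i => ?_, fun i => ?_⟩
  · rw [σ.graphAt_eq_graphAfter, ← hrange]
    simpa only [v, hsucc] using hmove (state i)
  · rw [σ.graphAt_eq_graphAfter, ← hrange]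
    exact (state i).2

/-- The vertices of `S` from which the runner cannot reach another vertex of `S` in one move. -/
def stranded (r : ℕ∞) (K : SimpleGraph V) (S : Set V) : Set V :=
  {v ∈ S | ∀ w ∈ S, CanMove r K v w → w = v}

theorem Strategy.not_isWinning {S : Set V} (hS : S.Nontrivial)
    (hstranded : ∀ K, IsKFlip k G K → (stranded r K S).Subsingleton) (hk : 1 ≤ k)
    (σ : Strategy G k) : ¬ σ.IsWinning r := by
  have hmobile (K : SimpleGraph V) (hK : IsKFlip k G K) {u w : V} (hu : u ∈ S) (hw : w ∈ S)
      (huw : w ≠ u) : u ∈ S \ stranded r K S ∨ w ∈ S \ stranded r K S := by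
    by_contra! h
    exact huw (hstranded K hK (not_not.1 fun h' => h.2 ⟨hw, h'⟩) (not_not.1 fun h' => h.1 ⟨hu, h'⟩))
  obtain ⟨v, hplay, hv⟩ := σ.exists_isPlay (r := r) (R := fun K v => v ∈ S \ stranded r K S)
    (by
      obtain ⟨u, hu, w, hw, huw⟩ := hS
      exact (hmobile G (isKFlip_self hk G) hu hw huw.symm).elim (⟨u, ·⟩) (⟨w, ·⟩))
    (by
      rintro K u ⟨hu, hstuck⟩ K' hK'
      simp only [stranded, Set.mem_ofPred_eq, not_and, not_forall] at hstuck
      obtain ⟨w, hw, hmove, hwu⟩ := hstuck hu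
      exact (hmobile K' hK' hu hw hwu).elim (⟨u, .refl r K u, ·⟩) (⟨w, hmove, ·⟩))
  intro hσ
  obtain ⟨i, -, hcaught⟩ := hσ v hplay
  refine (hv i).2 ⟨(hv i).1, fun w _ hmove => ?_⟩
  by_contra hne
  exact hmove.not_isIsolated hne hcaught

theorem add_one_le_flipWidth_of_stranded_subsingleton {S : Set V} (hS : S.Nontrivial)
    (hstranded : ∀ K, IsKFlip k G K → (stranded r K S).Subsingleton) :
    k + 1 ≤ flipWidth r G := by
  refine le_iInf₂ fun l ⟨hl, σ, hσ⟩ => ?_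
  by_contra! hlt
  have hlk : l ≤ k := Nat.lt_succ_iff.1 (mod_cast hlt)
  exact σ.not_isWinning hS (fun K hK => hstranded K (hK.mono hlk)) hl hσ

theorem exists_isWinning_of_forall_isSeparated [Finite V] {𝒳 : Set (Set V)} (huniv : Set.univ ∈ 𝒳)
    (hk : 1 ≤ k)
    (h𝒳 : ∀ X ∈ 𝒳, X.Nontrivial → ∃ K, IsKFlip k G K ∧
      ∀ v ∈ X, ∃ Y ∈ 𝒳, v ∈ Y ∧ Y ⊂ X ∧ IsSeparated K Y) :
    ∃ σ : Strategy G k, σ.IsWinning r := by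
  have hflip (X : Set V) : ∃ K, IsKFlip k G K ∧ (X ∈ 𝒳 → X.Nontrivial →
      ∀ v ∈ X, ∃ Y ∈ 𝒳, v ∈ Y ∧ Y ⊂ X ∧ IsSeparated K Y) := by
    by_cases hX : X ∈ 𝒳 ∧ X.Nontrivial
    · obtain ⟨K, hK, hsep⟩ := h𝒳 X hX.1 hX.2
      exact ⟨K, hK, fun _ _ => hsep⟩
    · exact ⟨G, isKFlip_self hk G, fun h h' => absurd ⟨h, h'⟩ hX⟩
  choose flip hflip hsep using hflip
  choose! part hpart using hsep
  let region (l : List V) : Set V := l.tail.foldl part Set.univ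
  refine ⟨⟨fun l => flip (region l), fun l => hflip _⟩, fun v hv => ?_⟩
  by_contra! hfree
  let X (i : ℕ) : Set V := region ((List.range (i + 1)).map v)
  have hsucc (i : ℕ) : X (i + 1) = part (X i) (v (i + 1)) := by
    simp [X, region, List.range_succ (n := i + 1)]
  have hX (i : ℕ) : X i ∈ 𝒳 ∧ (X i).Nontrivial ∧ v (i + 1) ∈ X i := by
    induction i with
    | zero =>
      refine ⟨huniv, ?_, trivial⟩
      rw [← Set.not_subsingleton_iff]
      intro hV
      have := Set.subsingleton_univ_iff.1 hV
      exact hfree 1 le_rfl (.of_subsingleton _ _)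
    | succ i ih =>
      obtain ⟨hmem, hv', -, hsep⟩ := hpart (X i) ih.1 ih.2.1 _ ih.2.2
      rw [hsucc]
      refine ⟨hmem, ?_, hsep.mem_of_canMove (hv (i + 1)) hv'⟩
      rw [← Set.not_subsingleton_iff]
      exact fun hsub => hfree (i + 1) (by simp) (hsep.isIsolated hsub hv')
  refine not_strictAnti_of_wellFoundedLT X (strictAnti_nat_of_succ_lt fun i => ?_)
  rw [hsucc]
  exact (hpart (X i) (hX i).1 (hX i).2.1 _ (hX i).2.2).2.2.1

end Game

section Obstructions

variable {V : Type*} {G : SimpleGraph V} {r : ℕ∞}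

/-- The induced path `0, 1, 2, 3` with a vertex `4` adjacent to the ends of the path if and only if
`x`, and to the inner vertices of the path if and only if `y`. -/
def obstruction (x y : Bool) : SimpleGraph (Fin 5) :=
  fromRel fun a b => (a, b) ∈ [(0, 1), (1, 2), (2, 3)] ++
    (if x then [(4, 0), (4, 3)] else []) ++ (if y then [(4, 1), (4, 2)] else [])

instance (x y : Bool) : DecidableRel (obstruction x y).Adj := by
  unfold obstruction; infer_instance

theorem c5_eq_obstruction : c5 = obstruction true false := by
  ext i j; revert i j; decide

theorem bull_eq_obstruction : bull = obstruction false true := rfl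

theorem gem_eq_obstruction : gem = obstruction true true := by
  unfold gem obstruction; congr! 3 with i j; revert i j; decide

theorem coGem_eq_obstruction : coGem = obstruction false false := rfl

theorem obsFree_iff_forall_obstruction :
    ObsFree G ↔ ∀ x y, ¬ (obstruction x y).IsIndContained G := by
  simp only [ObsFree, c5_eq_obstruction, bull_eq_obstruction, gem_eq_obstruction,
    coGem_eq_obstruction, Bool.forall_bool]
  tauto

theorem ObsFree.of_isIndContained {W : Type*} {H : SimpleGraph W} (hG : ObsFree G)
    (h : H.IsIndContained G) : ObsFree H :=
  obsFree_iff_forall_obstruction.2 fun x y hxy =>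
    obsFree_iff_forall_obstruction.1 hG x y (hxy.trans h)

theorem obstruction_isIndContained {x y : Bool} {a b c d v : V} (hab : G.Adj a b)
    (hbc : G.Adj b c) (hcd : G.Adj c d) (hac : ¬ G.Adj a c) (hbd : ¬ G.Adj b d)
    (had : ¬ G.Adj a d) (ha : G.Adj v a ↔ x) (hd : G.Adj v d ↔ x) (hb : G.Adj v b ↔ y)
    (hc : G.Adj v c ↔ y) :
    (obstruction x y).IsIndContained G := by
  have hadj (i j : Fin 5) :
      G.Adj (![a, b, c, d, v] i) (![a, b, c, d, v] j) ↔ (obstruction x y).Adj i j := by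
    wlog hij : i < j
    · obtain rfl | hji := (not_lt.1 hij).eq_or_lt
      · simp
      · rw [G.adj_comm, (obstruction x y).adj_comm]
        exact this hab hbc hcd hac hbd had ha hd hb hc j i hji
    rw [G.adj_comm v] at ha hb hc hd
    fin_cases i <;> fin_cases j <;> first | exact absurd hij (by decide) | skip
    all_goals cases x <;> cases y <;> simp_all [obstruction]
  have hinj : Function.Injective ![a, b, c, d, v] := by
    have htwinFree : ∀ x y, ∀ i j,
        (∀ k, (obstruction x y).Adj i k ↔ (obstruction x y).Adj j k) → i = j := by decide
    intro i j hij
    exact htwinFree x y i j fun k => by rw [← hadj, ← hadj, hij]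
  exact ⟨⟨⟨_, hinj⟩, hadj _ _⟩⟩

theorem adj_iff_adj_of_isIsolated_colorFlip {ι : Type*} {t : V → ι} {F : Set (Sym2 ι)} {a u w : V}
    (h : (colorFlip G t F).IsIsolated a) (hu : u ≠ a) (hw : w ≠ a) (ht : t u = t w) :
    G.Adj a u ↔ G.Adj a w := by
  have h' := h w
  have h := h u
  rw [colorFlip_adj hu.symm] at h
  rw [colorFlip_adj hw.symm, ← ht] at h'
  tauto

instance (n : ℕ) : DecidableRel (pathGraph n).Adj :=
  fun _ _ => decidable_of_iff _ pathGraph_adj.symm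

theorem rev_of_isIsolated_pathGraph {t : Fin 4 → Bool} {F : Set (Sym2 Bool)} {a b : Fin 4}
    (hab : a ≠ b) (ha : (colorFlip (pathGraph 4) t F).IsIsolated a)
    (hb : (colorFlip (pathGraph 4) t F).IsIsolated b) :
    b = a.rev ∧ ∀ i, t i.rev = !t i := by
  have hcolor : ∀ (t : Fin 4 → Bool) (a b : Fin 4), a ≠ b →
      (∀ c ∈ [a, b], ∀ u w, u ≠ c → w ≠ c → t u = t w →
        ((pathGraph 4).Adj c u ↔ (pathGraph 4).Adj c w)) →
      b = a.rev ∧ ∀ i, t i.rev = !t i := by decide +kernel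
  refine hcolor t a b hab fun c hc u w => adj_iff_adj_of_isIsolated_colorFlip (F := F) ?_
  obtain rfl | rfl : c = a ∨ c = b := by simpa using hc
  exacts [ha, hb]

theorem mem_iff_notMem_of_isIsolated_pathGraph {t : Fin 4 → Bool} {F : Set (Sym2 Bool)}
    {a : Fin 4} (ha : (colorFlip (pathGraph 4) t F).IsIsolated a) (c : Bool) :
    s(t a, !c) ∈ F ↔ s(t a, c) ∉ F := by
  have hmixed : ∀ a, ∃ u w, (pathGraph 4).Adj a u ∧ w ≠ a ∧ ¬ (pathGraph 4).Adj a w := by decide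
  obtain ⟨u, w, hu, hwa, hw⟩ := hmixed a
  have huw : t w = !t u := Bool.eq_not.2 fun h =>
    hw ((adj_iff_adj_of_isIsolated_colorFlip ha hu.ne' hwa h.symm).1 hu)
  have hmem : s(t a, t u) ∈ F := by simpa [colorFlip_adj hu.ne, hu] using ha u
  have hnotMem : s(t a, !t u) ∉ F := by simpa [colorFlip_adj hwa.symm, hw, huw] using ha w
  obtain rfl | rfl : c = t u ∨ c = !t u := Bool.eq_or_eq_not c (t u)
  · simp only [hmem, hnotMem, not_true]
  · simp only [Bool.not_not, hmem, hnotMem, not_false_eq_true]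

theorem comap_castSucc_obstruction (x y : Bool) :
    (obstruction x y).comap Fin.castSucc = pathGraph 4 := by
  ext i j; revert x y i j; decide

theorem obstruction_adj_castSucc_rev (x y : Bool) (i : Fin 4) :
    (obstruction x y).Adj 4 i.rev.castSucc ↔ (obstruction x y).Adj 4 i.castSucc := by
  revert x y i; decide

theorem isIsolated_comap_of_mem_stranded {W : Type*} {K : SimpleGraph V} (f : W ↪ V) (hr : 1 ≤ r)
    {w : W} (h : f w ∈ stranded r K (Set.range f)) : (K.comap f).IsIsolated w :=
  fun u hwu => hwu.ne' (f.injective (h.2 (f u) ⟨u, rfl⟩ (.of_adj hr hwu)))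

/- The vertex `4` shares its colour with one of the two isolated vertices `a` and `3 - a`, so its
adjacency in the obstruction is flipped towards exactly one of the two colours; these are
exchanged by the reversal of the path, which preserves the neighbourhood of `4`. -/
theorem colorFlip_obstruction_adj {x y : Bool} {t : Fin 5 → Bool} {F : Set (Sym2 Bool)} {a : Fin 4}
    (ha : (colorFlip (pathGraph 4) (t ∘ Fin.castSucc) F).IsIsolated a)
    (ha' : (colorFlip (pathGraph 4) (t ∘ Fin.castSucc) F).IsIsolated a.rev)
    (hrev : ∀ i : Fin 4, t i.rev.castSucc = !t i.castSucc) (i : Fin 4) :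
    (colorFlip (obstruction x y) t F).Adj 4 i.castSucc ∨
      (colorFlip (obstruction x y) t F).Adj 4 i.rev.castSucc := by
  have hF (c : Bool) : s(t 4, !c) ∈ F ↔ s(t 4, c) ∉ F := by
    obtain h | h : t 4 = t a.castSucc ∨ t 4 = t a.rev.castSucc :=
      hrev a ▸ Bool.eq_or_eq_not (t 4) _
    · exact h ▸ mem_iff_notMem_of_isIsolated_pathGraph ha c
    · exact h ▸ mem_iff_notMem_of_isIsolated_pathGraph ha' c
  have hne (j : Fin 4) : 4 ≠ j.castSucc := j.castSucc_ne_last.symm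
  rw [colorFlip_adj (hne i), colorFlip_adj (hne i.rev), obstruction_adj_castSucc_rev, hrev, hF]
  tauto

theorem stranded_range_castSucc_subsingleton (hr : 2 ≤ r) (x y : Bool) {K : SimpleGraph (Fin 5)}
    (hK : IsKFlip 2 (obstruction x y) K) :
    (stranded r K (Set.range (Fin.castSucc : Fin 4 → Fin 5))).Subsingleton := by
  obtain ⟨t, F, rfl⟩ := hK.exists_eq_colorFlip (ι := Bool) (by simp)
  rintro _ ⟨⟨a, rfl⟩, ha⟩ _ ⟨⟨b, rfl⟩, hb⟩
  by_contra! hab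
  have hisolated {c : Fin 4} (hc : ∀ w ∈ Set.range Fin.castSucc,
      CanMove r (colorFlip (obstruction x y) t F) c.castSucc w → w = c.castSucc) :
      (colorFlip (pathGraph 4) (t ∘ Fin.castSucc) F).IsIsolated c := by
    have h := isIsolated_comap_of_mem_stranded Fin.castSuccEmb (one_le_two.trans hr) ⟨⟨c, rfl⟩, hc⟩
    rwa [comap_colorFlip, Fin.coe_castSuccEmb, comap_castSucc_obstruction] at h
  obtain ⟨rfl, hrev⟩ :=
    rev_of_isIsolated_pathGraph (fun h => hab (congrArg _ h)) (hisolated ha) (hisolated hb)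
  have hmiddle := colorFlip_obstruction_adj (x := x) (y := y) (hisolated ha) (hisolated hb) hrev
  have hother : ∀ a : Fin 4, ∃ i, i ≠ a ∧ i ≠ a.rev ∧ i.rev ≠ a ∧ i.rev ≠ a.rev := by decide
  obtain ⟨i, hi⟩ := hother a
  have hstuck {c j : Fin 4} (hc : ∀ w ∈ Set.range Fin.castSucc,
      CanMove r (colorFlip (obstruction x y) t F) c.castSucc w → w = c.castSucc) (hj : j ≠ c)
      (hcadj : (colorFlip (obstruction x y) t F).Adj 4 c.castSucc)
      (hjadj : (colorFlip (obstruction x y) t F).Adj 4 j.castSucc) : False :=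
    hj (Fin.castSucc_injective 4 (hc _ ⟨j, rfl⟩ (.of_adj_adj hr hcadj.symm hjadj)))
  obtain h | h := hmiddle a <;> obtain h' | h' := hmiddle i
  · exact hstuck ha hi.1 h h'
  · exact hstuck ha hi.2.2.1 h h'
  · exact hstuck hb hi.2.1 h h'
  · exact hstuck hb hi.2.2.2 h h'

theorem three_le_flipWidth_obstruction (hr : 2 ≤ r) (x y : Bool) :
    3 ≤ flipWidth r (obstruction x y) := by
  have hpath : (Set.range (Fin.castSucc : Fin 4 → Fin 5)).Nontrivial :=
    ⟨_, ⟨0, rfl⟩, _, ⟨1, rfl⟩, by decide⟩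
  exact add_one_le_flipWidth_of_stranded_subsingleton hpath fun K =>
    stranded_range_castSucc_subsingleton hr x y

theorem obsFree_of_flipWidth_le_two (hr : 2 ≤ r) (h : flipWidth r G ≤ 2) : ObsFree G :=
  obsFree_iff_forall_obstruction.2 fun x y hxy =>
    absurd ((three_le_flipWidth_obstruction hr x y).trans ((flipWidth_mono hxy r).trans h))
      (by decide)

end Obstructions

section Switching

variable {V W : Type*} {G : SimpleGraph V} {H : SimpleGraph W}

/-- The Seidel switching of `G` that complements the adjacency between `s ⁻¹' {true}` and
`s ⁻¹' {false}`. -/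
def switch (G : SimpleGraph V) (s : V → Bool) : SimpleGraph V :=
  colorFlip G s {e | ¬ e.IsDiag}

theorem switch_adj {s : V → Bool} {u v : V} (h : u ≠ v) :
    (switch G s).Adj u v ↔ (G.Adj u v ↔ s u = s v) := by
  simp [switch, colorFlip_adj h]

instance [DecidableEq V] [DecidableRel G.Adj] (s : V → Bool) : DecidableRel (switch G s).Adj :=
  fun u v => decidable_of_iff (u ≠ v ∧ (G.Adj u v ↔ s u = s v))
    ⟨fun h => (switch_adj h.1).2 h.2, fun h => ⟨h.ne, (switch_adj h.ne).1 h⟩⟩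

theorem switch_switch (G : SimpleGraph V) (s t : V → Bool) :
    switch (switch G s) t = switch G fun v => s v ^^ t v := by
  ext u v
  by_cases huv : u = v
  · simp [huv]
  simp only [switch_adj huv]
  cases s u <;> cases s v <;> cases t u <;> cases t v <;> simp

theorem switch_switch_self (G : SimpleGraph V) (s : V → Bool) : switch (switch G s) s = G := by
  ext u v
  by_cases huv : u = v
  · simp [huv]
  simp only [switch_adj huv]
  tauto

theorem compl_switch (G : SimpleGraph V) (s : V → Bool) : (switch G s)ᶜ = switch Gᶜ s := by
  ext u v
  by_cases huv : u = v
  · simp [huv]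
  simp only [compl_adj, switch_adj huv]
  tauto

theorem comap_switch (G : SimpleGraph V) (s : V → Bool) (f : W ↪ V) :
    (switch G s).comap f = switch (G.comap f) (s ∘ f) :=
  comap_colorFlip G s _ f

theorem isKFlip_switch (G : SimpleGraph V) (s : V → Bool) : IsKFlip 2 G (switch G s) := by
  simpa [switch] using isKFlip_colorFlip G s {e | ¬ e.IsDiag}

theorem isKFlip_compl_switch (G : SimpleGraph V) (s : V → Bool) : IsKFlip 2 G (switch G s)ᶜ := by
  have hcompl : (switch G s)ᶜ = colorFlip G s {e | e.IsDiag} := by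
    ext u v
    by_cases huv : u = v
    · simp [huv]
    simp only [compl_adj, switch_adj huv, colorFlip_adj huv, Set.mem_ofPred_eq, Sym2.mk_isDiag_iff]
    tauto
  simpa [hcompl] using isKFlip_colorFlip G s {e | e.IsDiag}

theorem switch_isIndContained_switch (f : H ↪g G) (s : V → Bool) :
    (switch H (s ∘ f)).IsIndContained (switch G s) := by
  have hswitch : (switch G s).comap f.toEmbedding = switch H (s ∘ f) := by
    rw [comap_switch, show G.comap f.toEmbedding = H from f.comap_eq]
    rfl
  exact ⟨hswitch ▸ Embedding.comap f.toEmbedding (switch G s)⟩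

theorem exists_obstruction_isIndContained_switch_c5 (t : Fin 5 → Bool) :
    ∃ x y, (obstruction x y).IsIndContained (switch c5 t) := by
  -- A reflection of the pentagon preserves `t`; its fixed vertex `k` plays the role of `4`.
  have hreflection : ∀ t : Fin 5 → Bool, ∃ k, t (k + 4) = t (k + 1) ∧ t (k + 3) = t (k + 2) := by
    decide
  obtain ⟨k, h₁, h₂⟩ := hreflection t
  refine ⟨decide ((switch c5 t).Adj k (k + 1)), decide ((switch c5 t).Adj k (k + 2)), ?_⟩
  by_cases h : t (k + 1) = t (k + 2)
  · apply obstruction_isIndContained (a := k + 1) (b := k + 2) (c := k + 3) (d := k + 4) (v := k)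
      <;> (revert t k; decide +kernel)
  · apply obstruction_isIndContained (a := k + 1) (b := k + 3) (c := k + 2) (d := k + 4) (v := k)
      <;> (revert t k; decide +kernel)

theorem exists_c5_isIndContained_switch_obstruction (x y : Bool) :
    ∃ t, c5.IsIndContained (switch (obstruction x y) t) := by
  rw [c5_eq_obstruction]
  obtain rfl | rfl := Bool.eq_or_eq_not x y
  · refine ⟨![true, false, false, true, x], ?_⟩
    apply obstruction_isIndContained (a := 0) (b := 2) (c := 1) (d := 3) (v := 4) <;>
      (revert x; decide)
  · refine ⟨![false, false, false, false, y], ?_⟩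
    apply obstruction_isIndContained (a := 0) (b := 1) (c := 2) (d := 3) (v := 4) <;>
      (revert y; decide)

theorem obsFree_iff_forall_switch :
    ObsFree G ↔ ∀ s, ¬ c5.IsIndContained (switch G s) := by
  refine ⟨fun hG s ⟨f⟩ => ?_, fun h => obsFree_iff_forall_obstruction.2 fun x y ⟨f⟩ => ?_⟩
  · obtain ⟨x, y, hxy⟩ := exists_obstruction_isIndContained_switch_c5 (s ∘ f)
    have hc5 := switch_isIndContained_switch f s
    rw [switch_switch_self] at hc5
    exact obsFree_iff_forall_obstruction.1 hG x y (hxy.trans hc5)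
  · obtain ⟨t, ht⟩ := exists_c5_isIndContained_switch_obstruction x y
    have hf := switch_isIndContained_switch f (Function.extend f t fun _ => false)
    rw [Function.extend_comp f.injective] at hf
    exact h _ (ht.trans hf)

theorem ObsFree.switch (hG : ObsFree G) (s : V → Bool) : ObsFree (switch G s) :=
  obsFree_iff_forall_switch.2 fun t => by
    rw [switch_switch]
    exact obsFree_iff_forall_switch.1 hG _

/-- `G` has no induced path on four vertices. -/
def P4Free (G : SimpleGraph V) : Prop :=
  ∀ a b c d, G.Adj a b → G.Adj b c → G.Adj c d → ¬ G.Adj a c → ¬ G.Adj b d → G.Adj a d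

theorem ObsFree.p4Free_of_isIsolated (hG : ObsFree G) {v : V} (hv : G.IsIsolated v) :
    P4Free G := by
  intro a b c d hab hbc hcd hac hbd
  by_contra had
  have hcoGem : (obstruction false false).IsIndContained G :=
    obstruction_isIndContained (v := v) hab hbc hcd hac hbd had
      (by simp [hv a]) (by simp [hv d]) (by simp [hv b]) (by simp [hv c])
  exact obsFree_iff_forall_obstruction.1 hG _ _ hcoGem

theorem exists_isIsolated_switch (G : SimpleGraph V) (v : V) :
    ∃ s, (FlipWidth.switch G s).IsIsolated v := by
  classical
  refine ⟨fun u => decide (G.Adj v u), fun u hu => ?_⟩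
  simp [switch_adj hu.ne] at hu

theorem ObsFree.exists_p4Free_switch (hG : ObsFree G) : ∃ s, P4Free (FlipWidth.switch G s) := by
  obtain _ | ⟨⟨v⟩⟩ := isEmpty_or_nonempty V
  · exact ⟨fun _ => false, fun a => isEmptyElim a⟩
  · obtain ⟨s, hs⟩ := exists_isIsolated_switch G v
    exact ⟨s, (hG.switch s).p4Free_of_isIsolated hs⟩

end Switching

section Cographs

variable {V : Type*} {G : SimpleGraph V} {X A : Set V}

theorem P4Free.compl (hG : P4Free G) : P4Free Gᶜ := by
  intro a b c d
  simp only [compl_adj]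
  rintro ⟨hab, hab'⟩ ⟨-, hbc⟩ ⟨-, hcd⟩ hac hbd
  -- The complement of the induced path `a, b, c, d` is the induced path `c, a, d, b`.
  have hpath := hG c a d b
  grind [SimpleGraph.adj_comm, SimpleGraph.irrefl]

theorem completeTo_compl_iff {B : Set V} (hAB : Disjoint A B) :
    CompleteTo Gᶜ A B ↔ AnticompleteTo G A B := by
  refine forall₄_congr fun a ha b hb => ?_
  simp [compl_adj, hAB.ne_of_mem ha hb]

theorem anticompleteTo_compl_iff {B : Set V} (hAB : Disjoint A B) :
    AnticompleteTo Gᶜ A B ↔ CompleteTo G A B := by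
  rw [← completeTo_compl_iff hAB, compl_compl]

theorem CompleteTo.symm {B : Set V} (h : CompleteTo G A B) : CompleteTo G B A :=
  fun b hb a ha => (h a ha b hb).symm

theorem AnticompleteTo.symm {B : Set V} (h : AnticompleteTo G A B) : AnticompleteTo G B A :=
  fun b hb a ha hba => h a ha b hb hba.symm

/-- `A` and `X \ A` form a partition of `X` into two nonempty parts with all or no edges between
them, so that `G` induces a join or a disjoint union on `X`. -/
structure IsHomogeneousCut (G : SimpleGraph V) (X A : Set V) : Prop where
  nonempty : A.Nonempty
  ssubset : A ⊂ X
  completeTo_or_anticompleteTo : CompleteTo G A (X \ A) ∨ AnticompleteTo G A (X \ A)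

theorem IsHomogeneousCut.sdiff (h : IsHomogeneousCut G X A) : IsHomogeneousCut G X (X \ A) where
  nonempty := Set.nonempty_of_ssubset h.ssubset
  ssubset := h.ssubset.subset.sdiff_ssubset_of_nonempty h.nonempty
  completeTo_or_anticompleteTo := by
    rw [Set.sdiff_sdiff_cancel_left h.ssubset.subset]
    exact h.completeTo_or_anticompleteTo.imp .symm .symm

theorem IsHomogeneousCut.of_compl (h : IsHomogeneousCut Gᶜ X A) : IsHomogeneousCut G X A where
  nonempty := h.nonempty
  ssubset := h.ssubset
  completeTo_or_anticompleteTo := h.completeTo_or_anticompleteTo.symm.imp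
    (anticompleteTo_compl_iff Set.disjoint_sdiff_right).1
    (completeTo_compl_iff Set.disjoint_sdiff_right).1

theorem isHomogeneousCut_singleton {v : V} (hv : v ∉ X) (hX : X.Nonempty)
    (h : CompleteTo G {v} X ∨ AnticompleteTo G {v} X) :
    IsHomogeneousCut G (insert v X) {v} where
  nonempty := Set.singleton_nonempty v
  ssubset := by
    obtain ⟨x, hx⟩ := hX
    refine (Set.ssubset_iff_of_subset (by simp)).2 ⟨x, .inr hx, ?_⟩
    rintro rfl
    exact hv hx
  completeTo_or_anticompleteTo := by rwa [Set.insert_sdiff_self_of_notMem hv]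

theorem P4Free.exists_isHomogeneousCut_insert (hG : P4Free G) {v : V} (hv : v ∉ X)
    (hne : A.Nonempty) (hA : A ⊂ X) (h : AnticompleteTo G A (X \ A)) :
    ∃ B, IsHomogeneousCut G (insert v X) B := by
  by_cases hall : ∀ x ∈ X, G.Adj v x
  · refine ⟨{v}, isHomogeneousCut_singleton hv (hne.mono hA.subset) (.inl ?_)⟩
    rintro _ rfl
    exact hall
  push Not at hall
  obtain ⟨w, hwX, hw⟩ := hall
  wlog hwA : w ∈ A generalizing A
  · have hcut := IsHomogeneousCut.sdiff ⟨hne, hA, .inr h⟩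
    refine this hcut.nonempty hcut.ssubset ?_ ⟨hwX, hwA⟩
    rw [Set.sdiff_sdiff_cancel_left hA.subset]
    exact h.symm
  by_cases hd : ∃ d ∈ X \ A, G.Adj v d
  · obtain ⟨d, hd, hvd⟩ := hd
    refine ⟨{a ∈ A | ¬ G.Adj v a}, ⟨w, hwA, hw⟩, ?_, .inr ?_⟩
    · exact ((Set.sep_subset _ _).trans_ssubset hA).trans (Set.ssubset_insert hv)
    · rintro b ⟨hb, hvb⟩ x ⟨rfl | hx, hxb⟩ hbx
      · exact hvb hbx.symm
      · by_cases hxA : x ∈ A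
        · have hvx : G.Adj v x := not_not.1 fun hvx => hxb ⟨hxA, hvx⟩
          exact h b hb d hd (hG b x v d hbx hvx.symm hvd (hvb ·.symm) (h x hxA d hd))
        · exact h b hb x ⟨hx, hxA⟩ hbx
  · push Not at hd
    refine ⟨X \ A, Set.nonempty_of_ssubset hA, ?_, .inr ?_⟩
    · exact Set.sdiff_subset.trans_ssubset (Set.ssubset_insert hv)
    · rintro d hdX x ⟨rfl | hx, hxd⟩ hdx
      · exact hd d hdX hdx.symm
      · exact h x (not_not.1 fun hxA => hxd ⟨hx, hxA⟩) d hdX hdx.symm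

theorem P4Free.exists_isHomogeneousCut (hG : P4Free G) (hX : X.Finite) (hXn : X.Nontrivial) :
    ∃ A, IsHomogeneousCut G X A := by
  induction X, hX using Set.Finite.induction_on with
  | empty => simp at hXn
  | @insert v X hv _ ih =>
    obtain hXs | hXn := X.subsingleton_or_nontrivial
    · obtain rfl | ⟨x, rfl⟩ := hXs.eq_empty_or_singleton
      · simp at hXn
      · refine ⟨{v}, isHomogeneousCut_singleton hv (Set.singleton_nonempty x) ?_⟩
        simpa [CompleteTo, AnticompleteTo] using em _
    · obtain ⟨A, hne, hA, h | h⟩ := ih hXn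
      · rw [← anticompleteTo_compl_iff Set.disjoint_sdiff_right] at h
        obtain ⟨B, hB⟩ := hG.compl.exists_isHomogeneousCut_insert hv hne hA h
        exact ⟨B, hB.of_compl⟩
      · exact hG.exists_isHomogeneousCut_insert hv hne hA h

end Cographs

section Modules

variable {V : Type*} {G : SimpleGraph V} {X A : Set V}

/-- No vertex outside `X` distinguishes two vertices of `X`. -/
def IsModule (G : SimpleGraph V) (X : Set V) : Prop :=
  ∀ y ∉ X, CompleteTo G X {y} ∨ AnticompleteTo G X {y}

theorem isModule_univ (G : SimpleGraph V) : IsModule G Set.univ :=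
  fun y hy => absurd (Set.mem_univ y) hy

theorem IsModule.compl_graph (hX : IsModule G X) : IsModule Gᶜ X := by
  intro y hy
  have hdisj : Disjoint X {y} := Set.disjoint_singleton_right.2 hy
  exact (hX y hy).symm.imp (completeTo_compl_iff hdisj).2 (anticompleteTo_compl_iff hdisj).2

theorem IsModule.of_isHomogeneousCut (hX : IsModule G X) (h : IsHomogeneousCut G X A) :
    IsModule G A := by
  intro y hyA
  by_cases hyX : y ∈ X
  · exact h.completeTo_or_anticompleteTo.imp (fun hA a ha b hb => hA a ha b (hb ▸ ⟨hyX, hyA⟩))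
      (fun hA a ha b hb => hA a ha b (hb ▸ ⟨hyX, hyA⟩))
  · exact (hX y hyX).imp (fun hA a ha => hA a (h.ssubset.subset ha))
      (fun hA a ha => hA a (h.ssubset.subset ha))

theorem anticompleteTo_switch_iff {B : Set V} {t : V → Bool} (hAB : Disjoint A B) :
    AnticompleteTo (switch G t) A B ↔ ∀ a ∈ A, ∀ b ∈ B, (G.Adj a b ↔ t a ≠ t b) := by
  refine forall₄_congr fun a ha b hb => ?_
  rw [switch_adj (hAB.ne_of_mem ha hb)]
  tauto

theorem IsModule.exists_anticompleteTo_switch (hX : IsModule G X) :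
    ∃ t, (∀ x ∈ X, t x = false) ∧ AnticompleteTo (switch G t) X Xᶜ := by
  classical
  refine ⟨fun y => decide (y ∉ X ∧ CompleteTo G X {y}), fun x hx => by simp [hx], ?_⟩
  refine (anticompleteTo_switch_iff disjoint_compl_right).2 fun x hx y hy => ?_
  obtain hcomplete | hanti := hX y hy
  · simp [hx, show y ∉ X from hy, hcomplete, hcomplete x hx y rfl]
  · have hnot : ¬ CompleteTo G X {y} := fun hc => hanti x hx y rfl (hc x hx y rfl)
    simp [hx, hnot, hanti x hx y rfl]

theorem AnticompleteTo.switch {B : Set V} (h : AnticompleteTo G A B) {t : V → Bool}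
    (hA : ∀ a ∈ A, t a = false) (hB : ∀ b ∈ B, t b = false) :
    AnticompleteTo (FlipWidth.switch G t) A B := by
  intro a ha b hb hab
  rw [switch_adj hab.ne, hA a ha, hB b hb] at hab
  exact h a ha b hb (hab.2 rfl)

theorem isSeparated_of_anticompleteTo (hAX : A ⊆ X) (hA : AnticompleteTo G A (X \ A))
    (hX : AnticompleteTo G X Xᶜ) : IsSeparated G A := by
  intro a ha y hay
  by_contra hyA
  by_cases hyX : y ∈ X
  · exact hA a ha y ⟨hyX, hyA⟩ hay
  · exact hX a (hAX ha) y hyX hay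

theorem IsModule.exists_isKFlip_isSeparated {s : V → Bool} (hX : IsModule (switch G s) X)
    (hA : IsHomogeneousCut (switch G s) X A) :
    ∃ K, IsKFlip 2 G K ∧ IsSeparated K A ∧ IsSeparated K (X \ A) := by
  have hsep {H : SimpleGraph V} (hX : IsModule H X) (hcut : AnticompleteTo H A (X \ A)) :
      ∃ t, IsSeparated (switch H t) A ∧ IsSeparated (switch H t) (X \ A) := by
    obtain ⟨t, ht, hXt⟩ := hX.exists_anticompleteTo_switch
    have hAX := hA.ssubset.subset
    have hcut := hcut.switch (fun a ha => ht a (hAX ha)) (fun b hb => ht b hb.1)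
    refine ⟨t, isSeparated_of_anticompleteTo hAX hcut hXt,
      isSeparated_of_anticompleteTo Set.sdiff_subset ?_ hXt⟩
    rw [Set.sdiff_sdiff_cancel_left hAX]
    exact hcut.symm
  obtain hcomplete | hanti := hA.completeTo_or_anticompleteTo
  · obtain ⟨t, ht⟩ := hsep hX.compl_graph
      ((anticompleteTo_compl_iff Set.disjoint_sdiff_right).2 hcomplete)
    rw [← compl_switch, switch_switch] at ht
    exact ⟨_, isKFlip_compl_switch G _, ht⟩
  · obtain ⟨t, ht⟩ := hsep hX hanti
    rw [switch_switch] at ht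
    exact ⟨_, isKFlip_switch G _, ht⟩

theorem ObsFree.exists_isWinning [Finite V] (hG : ObsFree G) (r : ℕ∞) :
    ∃ σ : Strategy G 2, σ.IsWinning r := by
  obtain ⟨s, hs⟩ := hG.exists_p4Free_switch
  refine exists_isWinning_of_forall_isSeparated (𝒳 := {X | IsModule (FlipWidth.switch G s) X})
    (isModule_univ _) one_le_two fun X hX hXn => ?_
  obtain ⟨A, hA⟩ := hs.exists_isHomogeneousCut X.toFinite hXn
  obtain ⟨K, hK, hKA, hKA'⟩ := IsModule.exists_isKFlip_isSeparated hX hA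
  refine ⟨K, hK, fun v hv => ?_⟩
  by_cases hvA : v ∈ A
  · exact ⟨A, IsModule.of_isHomogeneousCut hX hA, hvA, hA.ssubset, hKA⟩
  · exact ⟨X \ A, IsModule.of_isHomogeneousCut hX hA.sdiff, ⟨hv, hvA⟩, hA.sdiff.ssubset, hKA'⟩

theorem ObsFree.flipWidth_le_two [Finite V] (hG : ObsFree G) (r : ℕ∞) : flipWidth r G ≤ 2 :=
  iInf₂_le 2 ⟨one_le_two, hG.exists_isWinning r⟩

theorem P4Free.exists_isModule_pair [Finite V] [Nontrivial V] (hG : P4Free G) :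
    ∃ x y, x ≠ y ∧ IsModule G {x, y} := by
  obtain ⟨X, ⟨hX, hXn⟩, hmin⟩ := exists_minimal_of_wellFoundedLT
    (fun X : Set V => IsModule G X ∧ X.Nontrivial) ⟨Set.univ, isModule_univ G, Set.nontrivial_univ⟩
  have hpart {A : Set V} (hA : IsHomogeneousCut G X A) : ∃ a, A = {a} :=
    hA.nonempty.exists_eq_singleton_or_nontrivial.resolve_right fun hAn =>
      hA.ssubset.not_subset (hmin ⟨hX.of_isHomogeneousCut hA, hAn⟩ hA.ssubset.subset)
  obtain ⟨A, hA⟩ := hG.exists_isHomogeneousCut X.toFinite hXn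
  obtain ⟨x, rfl⟩ := hpart hA
  obtain ⟨y, hy⟩ := hpart hA.sdiff
  have hXxy : X = {x, y} := by
    rw [← Set.union_sdiff_cancel hA.ssubset.subset, hy, Set.singleton_union]
  have hyx : y ∈ X \ {x} := hy ▸ rfl
  exact ⟨x, y, Ne.symm hyx.2, hXxy ▸ hX⟩

end Modules

section BiJoins

variable {V W : Type*} {G : SimpleGraph V} {H : SimpleGraph W} {V₁ V₂ : Set V}

theorem isBiJoin_iff_exists_switch :
    IsBiJoin G V₁ V₂ ↔ V₁.Nonempty ∧ V₂.Nonempty ∧ IsCompl V₁ V₂ ∧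
      ∃ t, AnticompleteTo (switch G t) V₁ V₂ := by
  classical
  have hcompl : IsCompl V₁ V₂ ↔ V₁ ∩ V₂ = ∅ ∧ V₁ ∪ V₂ = Set.univ :=
    isCompl_iff.trans (and_congr disjoint_iff codisjoint_iff)
  rw [IsBiJoin, hcompl, and_assoc]
  refine and_congr_right fun _ => and_congr_right fun _ => and_congr_right fun hinter =>
    and_congr_right fun _ => ?_
  have hdisj : Disjoint V₁ V₂ := Set.disjoint_iff_inter_eq_empty.2 hinter
  simp only [anticompleteTo_switch_iff hdisj]
  constructor
  · rintro ⟨W₁, hW₁, W₂, -, h₁₁, h₁₂, h₂₂, h₂₁⟩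
    refine ⟨fun v => decide (v ∈ W₁ ∪ V₂ \ W₂), fun a ha b hb => ?_⟩
    have haV₂ : a ∉ V₂ := Set.disjoint_left.1 hdisj ha
    have hbW₁ : b ∉ W₁ := fun h => Set.disjoint_left.1 hdisj (hW₁ h) hb
    by_cases haW : a ∈ W₁ <;> by_cases hbW : b ∈ W₂
    · simp [haW, hbW, hbW₁, h₁₁ a haW b hbW]
    · simp [haW, hbW, hb, h₁₂ a haW b ⟨hb, hbW⟩]
    · simp [haW, hbW, hbW₁, haV₂, h₂₁ a ⟨ha, haW⟩ b hbW]
    · simp [haW, hbW, hb, haV₂, h₂₂ a ⟨ha, haW⟩ b ⟨hb, hbW⟩]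
  · rintro ⟨t, ht⟩
    refine ⟨{a ∈ V₁ | t a}, Set.sep_subset _ _, {b ∈ V₂ | !t b}, Set.sep_subset _ _, ?_, ?_, ?_, ?_⟩
      <;> rintro a ⟨ha, ha'⟩ b ⟨hb, hb'⟩ <;> rw [ht a ha b hb] <;> simp_all

theorem IsBiJoin.switch (h : IsBiJoin G V₁ V₂) (s : V → Bool) :
    IsBiJoin (FlipWidth.switch G s) V₁ V₂ := by
  rw [isBiJoin_iff_exists_switch] at h ⊢
  obtain ⟨h₁, h₂, hcompl, t, ht⟩ := h
  refine ⟨h₁, h₂, hcompl, fun v => s v ^^ t v, ?_⟩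
  rwa [← switch_switch, switch_switch_self]

theorem IsModule.isBiJoin {X : Set V} (hX : IsModule G X) (hne : X.Nonempty) (hne' : Xᶜ.Nonempty) :
    IsBiJoin G X Xᶜ :=
  let ⟨t, _, ht⟩ := hX.exists_anticompleteTo_switch
  isBiJoin_iff_exists_switch.2 ⟨hne, hne', isCompl_compl, t, ht⟩

theorem IsBiJoin.preimage (h : IsBiJoin G V₁ V₂) (f : H ↪g G) (h₁ : (f ⁻¹' V₁).Nonempty)
    (h₂ : (f ⁻¹' V₂).Nonempty) : IsBiJoin H (f ⁻¹' V₁) (f ⁻¹' V₂) := by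
  rw [isBiJoin_iff_exists_switch] at h ⊢
  obtain ⟨-, -, hcompl, t, ht⟩ := h
  obtain rfl := hcompl.compl_eq
  refine ⟨h₁, h₂, isCompl_compl, t ∘ f, ?_⟩
  rw [anticompleteTo_switch_iff disjoint_compl_right] at ht
  refine (anticompleteTo_switch_iff disjoint_compl_right).2 fun a ha b hb => ?_
  rw [← f.map_adj_iff]
  exact ht _ ha _ hb

theorem IsBiJoin.subsingleton_of_c5 {V₁ V₂ : Set (Fin 5)} (h : IsBiJoin c5 V₁ V₂) :
    V₁.Subsingleton ∨ V₂.Subsingleton := by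
  classical
  have hc5 : ∀ p t : Fin 5 → Bool,
      (∀ a b, p a = true → p b = false → (c5.Adj a b ↔ t a ≠ t b)) →
      ∃ c, ∀ a b, p a = c → p b = c → a = b := by
    decide +kernel
  obtain ⟨-, -, hcompl, t, ht⟩ := isBiJoin_iff_exists_switch.1 h
  obtain rfl := hcompl.compl_eq
  rw [anticompleteTo_switch_iff disjoint_compl_right] at ht
  obtain ⟨c, hc⟩ := hc5 (fun v => decide (v ∈ V₁)) t fun a b ha hb =>
    ht a (by simpa using ha) b (by simpa using hb)
  cases c
  · exact .inr fun a ha b hb => hc a b (by simpa using ha) (by simpa using hb)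
  · exact .inl fun a ha b hb => hc a b (by simpa using ha) (by simpa using hb)

theorem CompletelyDecomposable.switch (hG : CompletelyDecomposable G) (s : V → Bool) :
    CompletelyDecomposable (FlipWidth.switch G s) := by
  intro S hS
  obtain ⟨V₁, V₂, h, h₁, h₂⟩ := hG S hS
  have hinduce : (FlipWidth.switch G s).induce S = FlipWidth.switch (G.induce S) (s ∘ (↑)) :=
    comap_switch G s (.subtype (· ∈ S))
  exact ⟨V₁, V₂, hinduce ▸ h.switch _, h₁, h₂⟩

theorem CompletelyDecomposable.not_c5_isIndContained (hG : CompletelyDecomposable G) :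
    ¬ c5.IsIndContained G := by
  rintro ⟨f⟩
  have hcard : (Set.range f).encard = 5 := by
    rw [← Set.image_univ, f.injective.encard_image, Set.encard_univ,
      ENat.card_eq_coe_fintype_card, Fintype.card_fin]
    rfl
  obtain ⟨V₁, V₂, h, h₁, h₂⟩ := hG (Set.range f) (hcard ▸ by decide)
  let e := f.isoInduceRange
  have hpreimage {Y : Set (Set.range f)} (hY : Y.Nonempty) (hY1 : Y.encard ≠ 1) :
      (e ⁻¹' Y).Nontrivial :=
    Set.Nontrivial.preimage (hY.exists_eq_singleton_or_nontrivial.resolve_left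
      fun h => hY1 (Set.encard_eq_one.2 h)) e.surjective
  have hpre₁ := hpreimage h.1 h₁
  have hpre₂ := hpreimage h.2.1 h₂
  obtain hs | hs := (h.preimage e.toEmbedding hpre₁.nonempty hpre₂.nonempty).subsingleton_of_c5
  · exact hpre₁.not_subsingleton hs
  · exact hpre₂.not_subsingleton hs

theorem CompletelyDecomposable.obsFree (hG : CompletelyDecomposable G) : ObsFree G :=
  obsFree_iff_forall_switch.2 fun s => (hG.switch s).not_c5_isIndContained

theorem ObsFree.completelyDecomposable [Finite V] (hG : ObsFree G) :
    CompletelyDecomposable G := by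
  intro S hS
  obtain ⟨s, hs⟩ := (hG.of_isIndContained ⟨Embedding.induce S⟩).exists_p4Free_switch
  have : Nontrivial S := by
    rw [Set.nontrivial_coe_sort, ← Set.one_lt_encard_iff_nontrivial]
    exact lt_of_lt_of_le (by decide) hS
  obtain ⟨x, y, hxy, hmodule⟩ := hs.exists_isModule_pair
  have hcompl : 1 < ({x, y} : Set S)ᶜ.encard := by
    have hsum := Set.encard_add_encard_compl ({x, y} : Set S)
    rw [Set.encard_pair hxy, Set.encard_univ, ENat.card_coe_set_eq] at hsum
    by_contra! hle
    exact absurd (hS.trans (hsum.symm.le.trans (add_le_add_right hle 2))) (by decide)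
  have hbiJoin := (hmodule.isBiJoin (Set.insert_nonempty _ _)
    (Set.encard_pos.1 (zero_lt_one.trans hcompl))).switch s
  rw [switch_switch_self] at hbiJoin
  exact ⟨_, _, hbiJoin, by rw [Set.encard_pair hxy]; decide, hcompl.ne'⟩

theorem obsFree_iff_completelyDecomposable [Finite V] : ObsFree G ↔ CompletelyDecomposable G :=
  ⟨ObsFree.completelyDecomposable, CompletelyDecomposable.obsFree⟩

end BiJoins

end FlipWidth

theorem theorem1 :
    (∀ (V : Type u) [Finite V] (G : SimpleGraph V),
      (∀ r : ℕ∞, 2 ≤ r → (FlipWidth.flipWidth r G ≤ 2 ↔ FlipWidth.ObsFree G)) ∧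
      (FlipWidth.ObsFree G ↔ FlipWidth.CompletelyDecomposable G) ∧
      (FlipWidth.ObsFree G → ∀ r : ℕ∞, 1 ≤ r → FlipWidth.flipWidth r G ≤ 2)) ∧
    (∀ r : ℕ∞, 2 ≤ r →
      3 ≤ FlipWidth.flipWidth r FlipWidth.c5 ∧ 3 ≤ FlipWidth.flipWidth r FlipWidth.bull ∧
      3 ≤ FlipWidth.flipWidth r FlipWidth.gem ∧ 3 ≤ FlipWidth.flipWidth r FlipWidth.coGem) := by
  refine ⟨fun V _ G => ⟨fun r hr => ⟨FlipWidth.obsFree_of_flipWidth_le_two hr,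
    fun hG => hG.flipWidth_le_two r⟩, FlipWidth.obsFree_iff_completelyDecomposable,
    fun hG r _ => hG.flipWidth_le_two r⟩, fun r hr => ?_⟩
  rw [FlipWidth.c5_eq_obstruction, FlipWidth.bull_eq_obstruction, FlipWidth.gem_eq_obstruction,
    FlipWidth.coGem_eq_obstruction]
  have hobstruction := FlipWidth.three_le_flipWidth_obstruction hr
  exact ⟨hobstruction _ _, hobstruction _ _, hobstruction _ _, hobstruction _ _⟩
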